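/- \textbf{Theorem.} Let $k,m\ge 1$. For $1\le i\le k$ let $G_i\in\{\mathbb R,[0,\infty)\}$, let $E_i\subset\mathbb R$ be a Borel set, and let $P_i(\cdot\mid s_i)$, $s_i\in G_i$, be probability distributions on $E_i$ depending measurably on $s_i$, with cumulative distribution functions $F_{i,s_i}$ and generalized inverses $F_{i,s_i}^{-1}(u)=\inf\{x: F_{i,s_i}(x)\ge u\}$. Put $G=G_1\times\cdots\times G_k$, $E=E_1\times\cdots\times E_k$, and $F_s^{-1}(u)=(F_{1,s_1}^{-1}(u_1),\ldots,F_{k,s_k}^{-1}(u_k))$ for $s\in G$, $u\in[0,1]^k$. Let $g:G\times E\times\mathbb R^m\to G$ be measurable. Let $(U_t,X_t)_{t\in\mathbb Z}$ be a process with values in $[0,1]^k\times\mathbb R^m$ such that the coordinates of $U_0$ are uniformly distributed on $[0,1]$, and let $\mathcal F_t=\sigma((U_s,X_s):s\le t)$. Write $|x|_1=\sum_i|x_i|$, let $|x|_{vec}$ be the vector of the absolute values of the coordinates of $x$, and let $\preccurlyeq$ be the coordinatewise order. Assume: \textbf{A1.} $(U_t,X_t)_{t\in\mathbb Z}$ is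 stationary and ergodic, and for every $t\in\mathbb Z$, $U_t$ is independent of $\mathcal F_{t-1}$. \textbf{A2.} There is $s\in G$ with $\mathbb E\,|g(s,F_s^{-1}(U_0),X_0)|_1<\infty$. \textbf{A3.} There is a $k\times k$ matrix $H$ with nonnegative entries and spectral radius $\rho(H)<1$ such that, almost surely, for all $s_1,s_2\in G$ simultaneously, $$\mathbb E\big[\,|g(s_1,F_{s_1}^{-1}(U_0),X_0)-g(s_2,F_{s_2}^{-1}(U_0),X_0)|_{vec}\,\big|\,\mathcal F_{-1}\big]\preccurlyeq H|s_1-s_2|_{vec},$$ where the conditional expectations are computed with one regular conditional distribution of $(U_0,X_0)$ given $\mathcal F_{-1}$. Then there is a process $(Y_t,\lambda_t)_{t\in\mathbb Z}$ with values in $E\times G$, unique up to almost sure equality, which is stationary, $(\mathcal F_t)_{t\in\mathbb Z}$-adapted, satisfies $\mathbb E|\lambda_0|_1<\infty$, and solves, almost surely for every $t\in\mathbb Z$, $$Y_t=F_{\lambda_t}^{-1}(U_t),\qquad \lambda_t=g(\lambda_{t-1},Y_{t-1},X_{t-1}).$$ Moreover, the process $(Y_t,\lambda_t,X_t)_{t\in\mathbb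 Z}$ is stationary and ergodic. -/

import Mathlib

open MeasureTheory ProbabilityTheory

noncomputable section

namespace ObsDriven

/-- The left shift on two-sided sequences. -/
def shift {S : Type*} (z : ℤ → S) : ℤ → S := fun t => z (t + 1)

/-- The path of a two-sided process, as a random sequence. -/
def path {Ω S : Type*} (Z : ℤ → Ω → S) (ω : Ω) : ℤ → S := fun t => Z t ω

/-- Strict stationarity of a process indexed by the integers: its law on the sequence space
(with the product sigma-algebra) is invariant under the shift. -/
def IsStationary {Ω S : Type*} [MeasurableSpace Ω] [MeasurableSpace S]
    (Z : ℤ → Ω → S) (μ : Measure Ω) : Prop :=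
  (∀ t, Measurable (Z t)) ∧ MeasurePreserving shift (μ.map (path Z)) (μ.map (path Z))

/-- A stationary and ergodic process: the shift preserves its law on the sequence space and every
measurable shift-invariant set of sequences is null or conull for that law. -/
def IsStationaryErgodic {Ω S : Type*} [MeasurableSpace Ω] [MeasurableSpace S]
    (Z : ℤ → Ω → S) (μ : Measure Ω) : Prop :=
  (∀ t, Measurable (Z t)) ∧ Ergodic shift (μ.map (path Z))

/-- The sigma-algebra `F_t` generated by `Z_s`, `s ≤ t`. -/
abbrev pastSigma {Ω S : Type*} [MeasurableSpace S] (Z : ℤ → Ω → S) (t : ℤ) : MeasurableSpace Ω :=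
  ⨆ s : {s : ℤ // s ≤ t}, MeasurableSpace.comap (Z s) inferInstance

/-- The past `(Z_{-1}, Z_{-2}, …)` before time `0`, as a random sequence. -/
def past {Ω S : Type*} (Z : ℤ → Ω → S) (ω : Ω) : ℕ → S := fun n => Z (-1 - (n : ℤ)) ω

/-- The sigma-algebra generated by the past sequence is `F_{-1}`. -/
theorem comap_past {Ω S : Type*} [MeasurableSpace S] (Z : ℤ → Ω → S) :
    MeasurableSpace.comap (past Z) inferInstance = pastSigma Z (-1) := by
  apply le_antisymm
  · rw [← measurable_iff_comap_le]
    refine @measurable_pi_lambda _ _ _ (pastSigma Z (-1)) _ _ fun n => ?_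
    rw [measurable_iff_comap_le]
    exact le_iSup (fun s : {s : ℤ // s ≤ -1} => MeasurableSpace.comap (Z s) inferInstance)
      ⟨-1 - (n : ℤ), by omega⟩
  · refine iSup_le fun s => ?_
    rw [← measurable_iff_comap_le]
    have h : Z s = fun ω => past Z ω (-1 - (s : ℤ)).toNat := by
      have hs := s.2
      have : -1 - (((-1 - (s : ℤ)).toNat : ℕ) : ℤ) = s := by omega
      funext ω
      simp only [past, this]
    rw [h]
    exact (measurable_pi_apply _).comp (comap_measurable (past Z))

/-- The regular conditional distribution of `Z_0` given `F_{-1}`, the sigma-algebra generated by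
`Z_{-1}, Z_{-2}, …`, at the outcome `ω`. -/
def condLaw {Ω S : Type*} [MeasurableSpace Ω] [MeasurableSpace S] [StandardBorelSpace S]
    [Nonempty S] (Z : ℤ → Ω → S) (μ : Measure Ω) [IsFiniteMeasure μ] (ω : Ω) : Measure S :=
  condDistrib (Z 0) (past Z) μ (past Z ω)

/-- The generalized inverse `u ↦ inf {x | u ≤ F x}` of the cumulative distribution function `F`
of a probability measure on the line (its values outside `0 < u < 1` are immaterial). -/
def quantile (ν : Measure ℝ) (u : ℝ) : ℝ := sInf {x : ℝ | u ≤ cdf ν x}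

/-- The vector `F_s^{-1}(u)` with coordinates `F_{i,s_i}^{-1}(u_i)`. -/
def quantileVec {k : ℕ} {G : Fin k → Set ℝ} (P : (i : Fin k) → Kernel (G i) ℝ)
    (s : (i : Fin k) → G i) (u : Fin k → ℝ) : Fin k → ℝ :=
  fun i => quantile (P i (s i)) (u i)

/-- The input process `(U_t, X_t)`. -/
def inputs {Ω : Type*} {k m : ℕ} (U : ℤ → Ω → Fin k → ℝ) (X : ℤ → Ω → Fin m → ℝ) :
    ℤ → Ω → (Fin k → ℝ) × (Fin m → ℝ) :=
  fun t ω => (U t ω, X t ω)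

/-- The inputs `(U_t, X_t)` are stationary and ergodic, and each `U_t` is independent of
`F_{t-1}`. -/
def InputAssumption {Ω : Type*} [MeasurableSpace Ω] {k m : ℕ}
    (U : ℤ → Ω → Fin k → ℝ) (X : ℤ → Ω → Fin m → ℝ) (μ : Measure Ω) : Prop :=
  IsStationaryErgodic (inputs U X) μ ∧
    ∀ t, Indep (MeasurableSpace.comap (U t) inferInstance) (pastSigma (inputs U X) (t - 1)) μ

/-- For some `s ∈ G`, `g(s, F_s^{-1}(U_0), X_0)` is integrable. -/
def IntegrabilityAssumption {Ω : Type*} [MeasurableSpace Ω] {k m : ℕ} {G : Fin k → Set ℝ}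
    (P : (i : Fin k) → Kernel (G i) ℝ)
    (g : ((i : Fin k) → G i) → (Fin k → ℝ) → (Fin m → ℝ) → Fin k → ℝ)
    (U : ℤ → Ω → Fin k → ℝ) (X : ℤ → Ω → Fin m → ℝ) (μ : Measure Ω) : Prop :=
  ∃ s : (i : Fin k) → G i,
    Integrable (fun ω => ∑ i, |g s (quantileVec P s (U 0 ω)) (X 0 ω) i|) μ

/-- There is a nonnegative square matrix `H` with spectral radius `< 1` such that almost surely,
for all `s₁, s₂ ∈ G` simultaneously, the conditional expectation given `F_{-1}` of
`|g(s₁, F_{s₁}^{-1}(U_0), X_0) - g(s₂, F_{s₂}^{-1}(U_0), X_0)|` is at most `H |s₁ - s₂|`,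
coordinatewise. The conditional expectations are integrals against one regular conditional
distribution of `(U_0, X_0)` given `F_{-1}`. -/
def ContractionAssumption {Ω : Type*} [MeasurableSpace Ω] {k m : ℕ} {G : Fin k → Set ℝ}
    (P : (i : Fin k) → Kernel (G i) ℝ)
    (g : ((i : Fin k) → G i) → (Fin k → ℝ) → (Fin m → ℝ) → Fin k → ℝ)
    (U : ℤ → Ω → Fin k → ℝ) (X : ℤ → Ω → Fin m → ℝ) (μ : Measure Ω) [IsFiniteMeasure μ] : Prop :=
  ∃ H : Matrix (Fin k) (Fin k) ℝ, (∀ i j, 0 ≤ H i j) ∧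
    spectralRadius ℂ (H.map (fun x : ℝ => (x : ℂ))) < 1 ∧
    ∀ᵐ ω ∂μ, ∀ s₁ s₂ : (i : Fin k) → G i, ∀ i : Fin k,
      ∫⁻ z, ENNReal.ofReal
          |g s₁ (quantileVec P s₁ z.1) z.2 i - g s₂ (quantileVec P s₂ z.1) z.2 i|
          ∂(condLaw (inputs U X) μ ω)
        ≤ ENNReal.ofReal (∑ j, H i j * |(s₁ j : ℝ) - (s₂ j : ℝ)|)

/-- `(Y_t, λ_t)` is an `E × G`-valued, stationary, `(F_t)`-adapted process with `E|λ_0|₁ < ∞` which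
solves, almost surely for each `t`, `Y_t = F_{λ_t}^{-1}(U_t)` and
`λ_t = g(λ_{t-1}, Y_{t-1}, X_{t-1})`. -/
structure IsStationarySolution {Ω : Type*} [MeasurableSpace Ω] {k m : ℕ} {G : Fin k → Set ℝ}
    (E : Fin k → Set ℝ) (P : (i : Fin k) → Kernel (G i) ℝ)
    (g : ((i : Fin k) → G i) → (Fin k → ℝ) → (Fin m → ℝ) → Fin k → ℝ)
    (U : ℤ → Ω → Fin k → ℝ) (X : ℤ → Ω → Fin m → ℝ) (μ : Measure Ω)
    (Y : ℤ → Ω → Fin k → ℝ) (lam : ℤ → Ω → (i : Fin k) → G i) : Prop where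
  mem_E : ∀ t, ∀ᵐ ω ∂μ, ∀ i, Y t ω i ∈ E i
  observation_eq : ∀ t, ∀ᵐ ω ∂μ, Y t ω = quantileVec P (lam t ω) (U t ω)
  latent_eq : ∀ t, ∀ᵐ ω ∂μ, ∀ i,
    (lam t ω i : ℝ) = g (lam (t - 1) ω) (Y (t - 1) ω) (X (t - 1) ω) i
  stationary : IsStationary (fun t ω => (Y t ω, lam t ω)) μ
  adapted_Y : ∀ t, Measurable[pastSigma (inputs U X) t] (Y t)
  adapted_lam : ∀ t, Measurable[pastSigma (inputs U X) t] (lam t)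
  integrable : Integrable (fun ω => ∑ i, |(lam 0 ω i : ℝ)|) μ

end ObsDriven

end

/-! The latent variable is sought as one measurable function `L` of the past inputs: `λ_t =
L(Z_{t-1}, Z_{t-2}, …)` with `Z = (U, X)`. The recursion then becomes the fixed point equation
`update L = L`, almost everywhere for the law `π` of the past.

`update` is a contraction in the integrated distance. Conditionally on the past, `W₁` and `W₂` are
constants, so A3 applies with these values as `s₁`, `s₂`; this is where one null set for all pairs
is needed. Integrating over the past and using stationarity gives `lintegral_update_le`. A matrix
bound is not yet a contraction, but `ρ(H) < 1` yields weights `w` with `wᵀH ≤ c wᵀ`, `c < 1`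
(`exists_weights`), so a weighted `ℓ¹` distance contracts. A2 makes the first Picard step finite,
and `exists_fixedPoint` produces `L`.

With `Y_t` defined as the quantile at level `U_t`, independence of `U_t` from the past puts `Y_t` in
`E` (`ae_quantileVec_mem`). All variables are then one function of the translated input path, and
stationarity and ergodicity pass to such factors.

For uniqueness, any solution satisfies `λ'_t = W_t(past)`. Its integrated distance to `L` shrinks by
`c` at each time step and is bounded uniformly in `t`, so iterating from the remote past makes it
zero. -/

namespace ObsDriven

/-! ### Matrices of spectral radius less than one. -/

open Filter Topology in
/-- The entries of the powers of a complex matrix with spectral radius less than one decay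
geometrically. -/
theorem exists_norm_pow_apply_le {k : ℕ} (A : Matrix (Fin k) (Fin k) ℂ)
    (hA : spectralRadius ℂ A < 1) :
    ∃ r : ℝ, 0 < r ∧ r < 1 ∧ ∀ᶠ n : ℕ in atTop, ∀ i j, ‖(A ^ n) i j‖ ≤ r ^ n := by
  let _ : NormedRing (Matrix (Fin k) (Fin k) ℂ) := Matrix.linftyOpNormedRing
  let _ : NormedAlgebra ℂ (Matrix (Fin k) (Fin k) ℂ) := Matrix.linftyOpNormedAlgebra
  have : CompleteSpace (Matrix (Fin k) (Fin k) ℂ) := FiniteDimensional.complete ℂ _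
  -- Gelfand's formula: any `r` strictly between the spectral radius and `1` eventually dominates
  -- the `n`-th root of the norm of `A ^ n`.
  have hlim := spectrum.pow_nnnorm_pow_one_div_tendsto_nhds_spectralRadius A
  obtain ⟨r, hr, hr1⟩ := ENNReal.lt_iff_exists_nnreal_btwn.mp hA
  have hr0 : 0 < r := by
    have := pos_of_gt hr
    exact_mod_cast this
  refine ⟨r, by exact_mod_cast hr0, by exact_mod_cast hr1, ?_⟩
  filter_upwards [hlim.eventually_lt_const hr, eventually_ge_atTop 1] with n hn hn1 i j
  have hn0 : (n : ℝ) ≠ 0 := by positivity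
  have h1 : (‖A ^ n‖₊ : ENNReal) ≤ (r : ENNReal) ^ n := by
    have := ENNReal.rpow_le_rpow hn.le (Nat.cast_nonneg (α := ℝ) n)
    rwa [← ENNReal.rpow_mul, one_div, inv_mul_cancel₀ hn0, ENNReal.rpow_one,
      ENNReal.rpow_natCast] at this
  have h2 : ‖A ^ n‖₊ ≤ r ^ n := by exact_mod_cast h1
  have h3 : ‖(A ^ n) i j‖₊ ≤ ‖A ^ n‖₊ := by
    rw [Matrix.linfty_opNNNorm_def]
    exact (Finset.single_le_sum (f := fun j => ‖(A ^ n) i j‖₊) (fun _ _ => zero_le)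
      (Finset.mem_univ j)).trans
      (Finset.le_sup (f := fun i => ∑ j, ‖(A ^ n) i j‖₊) (Finset.mem_univ i))
  exact_mod_cast h3.trans h2

open Filter Topology in
/-- A nonnegative matrix with spectral radius less than one contracts a weighted `ℓ¹` norm. -/
theorem exists_weights {k : ℕ} (H : Matrix (Fin k) (Fin k) ℝ) (hH : ∀ i j, 0 ≤ H i j)
    (hs : spectralRadius ℂ (H.map (fun x : ℝ => (x : ℂ))) < 1) :
    ∃ (w : Fin k → ℝ) (c : ℝ), (∀ i, 1 ≤ w i) ∧ 0 ≤ c ∧ c < 1 ∧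
      ∀ j, ∑ i, w i * H i j ≤ c * w j := by
  obtain ⟨r, hr0, hr1, hr⟩ := exists_norm_pow_apply_le _ hs
  obtain ⟨c, hrc, hc1⟩ := exists_between hr1
  have hc0 : 0 < c := hr0.trans hrc
  -- Selects `N` with `k * r ^ N < c ^ N`, which bounds the column sums of `H ^ N` by `c ^ N`.
  have hlim : Tendsto (fun n : ℕ => (k : ℝ) * (r / c) ^ n) atTop (𝓝 0) := by
    simpa using (tendsto_pow_atTop_nhds_zero_of_lt_one (by positivity)
      ((div_lt_one hc0).2 hrc)).const_mul (k : ℝ)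
  obtain ⟨N, hN, hN1, hNpos⟩ :=
    (hr.and ((hlim.eventually_lt_const one_pos).and (eventually_ge_atTop 1))).exists
  have hpow : ∀ n i j, 0 ≤ (H ^ n) i j := by
    intro n
    induction n with
    | zero => intro i j; rw [pow_zero, Matrix.one_apply]; split_ifs <;> norm_num
    | succ n ih =>
      intro i j
      rw [pow_succ, Matrix.mul_apply]
      exact Finset.sum_nonneg fun l _ => mul_nonneg (ih i l) (hH l j)
  have hcol : ∀ j, ∑ i, (H ^ N) i j ≤ c ^ N := by
    intro j
    have hle : ∀ i, (H ^ N) i j ≤ r ^ N := by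
      intro i
      have h := hN i j
      have hmap : (H.map (fun x : ℝ => (x : ℂ))) ^ N = (H ^ N).map (fun x : ℝ => (x : ℂ)) :=
        (Matrix.map_pow H Complex.ofRealHom N).symm
      rw [hmap, Matrix.map_apply, Complex.norm_real, Real.norm_eq_abs] at h
      exact (le_abs_self _).trans h
    calc ∑ i, (H ^ N) i j ≤ ∑ _i : Fin k, r ^ N := Finset.sum_le_sum fun i _ => hle i
      _ = (k * (r / c) ^ N) * c ^ N := by
        rw [Finset.sum_const, Finset.card_univ, Fintype.card_fin, nsmul_eq_mul, div_pow]
        field_simp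
      _ ≤ 1 * c ^ N := by gcongr
      _ = c ^ N := one_mul _
  -- The weights are the truncated Neumann series `w = ∑_{n<N} v n` with `v n = c⁻ⁿ 1ᵀHⁿ`. Since `v
  -- n H = c v (n + 1)`, the sum telescopes to `wᵀH = c (w - v 0 + v N)`, and `v N ≤ 1 = v 0`.
  set v : ℕ → Fin k → ℝ := fun n j => (c⁻¹) ^ n * ∑ i, (H ^ n) i j with hv
  have hv0 : ∀ j, v 0 j = 1 := by
    intro j
    simp [hv, Matrix.one_apply]
  have hvnn : ∀ n j, 0 ≤ v n j := fun n j =>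
    mul_nonneg (by positivity) (Finset.sum_nonneg fun i _ => hpow n i j)
  have hstep : ∀ n j, ∑ i, v n i * H i j = c * v (n + 1) j := by
    intro n j
    simp only [hv, pow_succ H n, Matrix.mul_apply]
    rw [Finset.sum_comm, pow_succ c⁻¹ n]
    simp only [Finset.mul_sum, Finset.sum_mul]
    refine Finset.sum_congr rfl fun i _ => Finset.sum_congr rfl fun l _ => ?_
    field_simp
  refine ⟨fun j => ∑ n ∈ Finset.range N, v n j, c, ?_, hc0.le, hc1, ?_⟩
  · intro j
    rw [← hv0 j]
    exact Finset.single_le_sum (f := fun n => v n j) (fun n _ => hvnn n j)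
      (Finset.mem_range.2 hNpos)
  · intro j
    have hN' : v N j ≤ 1 := by
      simp only [hv]
      calc (c⁻¹) ^ N * ∑ i, (H ^ N) i j ≤ (c⁻¹) ^ N * c ^ N := by
            gcongr
            exact hcol j
        _ = 1 := by rw [← mul_pow, inv_mul_cancel₀ hc0.ne', one_pow]
    calc ∑ i, (∑ n ∈ Finset.range N, v n i) * H i j
        = ∑ n ∈ Finset.range N, c * v (n + 1) j := by
          simp only [Finset.sum_mul]
          rw [Finset.sum_comm]
          exact Finset.sum_congr rfl fun n _ => hstep n j
      _ = c * ∑ n ∈ Finset.range N, v (n + 1) j := by rw [Finset.mul_sum]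
      _ ≤ c * ∑ n ∈ Finset.range N, v n j := by
          have h1 := Finset.sum_range_succ' (fun n => v n j) N
          have h2 := Finset.sum_range_succ (fun n => v n j) N
          have := hv0 j
          exact mul_le_mul_of_nonneg_left (by linarith) hc0.le

end ObsDriven

/-! ### Quantile functions. -/

namespace ObsDriven

open Filter Topology

/-- Right continuity of the distribution function means that the infimum is attained. The hypotheses
make the set bounded below and nonempty, excluding the default value of `sInf`. -/
theorem quantile_le_iff {ν : Measure ℝ} {u x : ℝ} (hu : 0 < u) (hne : ∃ y, u ≤ cdf ν y) :
    quantile ν u ≤ x ↔ u ≤ cdf ν x := by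
  have hbdd : BddBelow {x : ℝ | u ≤ cdf ν x} := by
    obtain ⟨b, hb⟩ := ((tendsto_cdf_atBot ν).eventually_lt_const hu).exists
    refine ⟨b, fun y hy => ?_⟩
    by_contra! hlt
    exact absurd (hy.trans (monotone_cdf ν hlt.le)) (not_le.2 hb)
  constructor
  · intro h
    have hright : Tendsto (cdf ν) (𝓝[>] x) (𝓝 (cdf ν x)) :=
      ((cdf ν).right_continuous x).mono_left (nhdsWithin_mono _ Set.Ioi_subset_Ici_self)
    refine ge_of_tendsto hright ?_
    filter_upwards [self_mem_nhdsWithin] with y hy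
    obtain ⟨z, hz, hzy⟩ := exists_lt_of_csInf_lt (s := {x : ℝ | u ≤ cdf ν x}) hne
      (lt_of_le_of_lt h hy)
    exact le_trans hz (monotone_cdf ν hzy.le)
  · exact fun h => csInf_le hbdd h

theorem quantile_of_nonpos {ν : Measure ℝ} {u : ℝ} (hu : u ≤ 0) : quantile ν u = 0 := by
  have : {x : ℝ | u ≤ cdf ν x} = Set.univ :=
    Set.eq_univ_of_forall fun x => hu.trans (cdf_nonneg ν x)
  rw [quantile, this, Real.sInf_univ]

theorem quantile_of_forall_lt {ν : Measure ℝ} {u : ℝ} (hu : ¬ ∃ y, u ≤ cdf ν y) :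
    quantile ν u = 0 := by
  have : {x : ℝ | u ≤ cdf ν x} = ∅ :=
    Set.eq_empty_of_forall_notMem fun x hx => hu ⟨x, hx⟩
  rw [quantile, this, Real.sInf_empty]

/-- Sublevel sets are described by `quantile_le_iff` where it applies; elsewhere `sInf` is taken
over the whole line or the empty set and equals `0`. -/
theorem measurable_quantile {α : Type*} [MeasurableSpace α] (κ : Kernel α ℝ) [IsMarkovKernel κ] :
    Measurable fun p : α × ℝ => quantile (κ p.1) p.2 := by
  have hF : ∀ x : ℝ, MeasurableSet {p : α × ℝ | p.2 ≤ cdf (κ p.1) x} := by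
    intro x
    have h : Measurable fun p : α × ℝ => cdf (κ p.1) x := by
      simp_rw [cdf_eq_real, Measure.real]
      exact ((κ.measurable_coe measurableSet_Iic).comp measurable_fst).ennreal_toReal
    exact measurableSet_le measurable_snd h
  have hA : MeasurableSet {p : α × ℝ | 0 < p.2 ∧ ∃ y, p.2 ≤ cdf (κ p.1) y} := by
    have : {p : α × ℝ | 0 < p.2 ∧ ∃ y, p.2 ≤ cdf (κ p.1) y} =
        {p | 0 < p.2} ∩ ⋃ n : ℕ, {p | p.2 ≤ cdf (κ p.1) n} := by
      ext p
      simp only [Set.mem_inter_iff, Set.mem_ofPred_eq, Set.mem_iUnion]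
      refine and_congr_right fun _ => ⟨fun ⟨y, hy⟩ => ?_, fun ⟨n, hn⟩ => ⟨n, hn⟩⟩
      obtain ⟨n, hn⟩ := exists_nat_ge y
      exact ⟨n, hy.trans (monotone_cdf _ hn)⟩
    rw [this]
    exact (measurableSet_lt measurable_const measurable_snd).inter
      (MeasurableSet.iUnion fun n => hF n)
  refine measurable_of_Iic fun x => ?_
  have : (fun p : α × ℝ => quantile (κ p.1) p.2) ⁻¹' Set.Iic x =
      Set.ite {p : α × ℝ | 0 < p.2 ∧ ∃ y, p.2 ≤ cdf (κ p.1) y}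
        {p | p.2 ≤ cdf (κ p.1) x} {_p | 0 ≤ x} := by
    ext p
    by_cases hp : 0 < p.2 ∧ ∃ y, p.2 ≤ cdf (κ p.1) y
    · have := quantile_le_iff (x := x) hp.1 hp.2
      simp [Set.ite, hp.1, hp.2, this]
    · have h0 : quantile (κ p.1) p.2 = 0 := by
        by_cases h : 0 < p.2
        · exact quantile_of_forall_lt fun h' => hp ⟨h, h'⟩
        · exact quantile_of_nonpos (not_lt.1 h)
      simp only [Set.ite, Set.mem_preimage, Set.mem_Iic, h0, Set.mem_union, Set.mem_inter_iff,
        Set.mem_ofPred_eq, Set.mem_sdiff, hp, and_false, not_false_eq_true, and_true, false_or]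
  rw [this]
  exact hA.ite (hF x) (MeasurableSet.const _)

/-- The quantile function pushes the uniform distribution forward to the given law. -/
theorem map_quantile_uniform (ν : Measure ℝ) [IsProbabilityMeasure ν] :
    ((volume : Measure ℝ).restrict (Set.Icc 0 1)).map (quantile ν) = ν := by
  have hm : Measurable (quantile ν) :=
    (measurable_quantile (Kernel.const Unit ν)).comp (measurable_prodMk_left (x := ()))
  refine Measure.ext_of_Iic _ _ fun x => ?_
  -- The levels `0` and `1`, where default values may occur, form a null set and are dropped.
  rw [Measure.map_apply hm measurableSet_Iic,
    Measure.restrict_congr_set Ioo_ae_eq_Icc.symm,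
    Measure.restrict_apply (hm measurableSet_Iic)]
  have h1 : quantile ν ⁻¹' Set.Iic x ∩ Set.Ioo 0 1 = Set.Ioc 0 (cdf ν x) ∩ Set.Ioo 0 1 := by
    ext u
    simp only [Set.mem_inter_iff, Set.mem_preimage, Set.mem_Iic, Set.mem_Ioo, Set.mem_Ioc]
    refine ⟨fun ⟨h, hu⟩ => ?_, fun ⟨h, hu⟩ => ?_⟩ <;>
    · have hex : ∃ y, u ≤ cdf ν y :=
        (((tendsto_cdf_atTop ν).eventually_const_lt hu.2).exists).imp fun _ h => h.le
      have := quantile_le_iff (x := x) hu.1 hex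
      tauto
  have h2 : (Set.Ioc 0 (cdf ν x) ∩ Set.Ioo 0 1 : Set ℝ) =ᵐ[volume] Set.Ioc 0 (cdf ν x) := by
    have h3 : (Set.Ioc 0 (cdf ν x) ∩ Set.Ioo 0 1 : Set ℝ) =ᵐ[volume]
        (Set.Ioc 0 (cdf ν x) ∩ Set.Ioc 0 1 : Set ℝ) :=
      Filter.EventuallyEq.rfl.inter Ioo_ae_eq_Ioc
    rwa [Set.inter_eq_left.2 (Set.Ioc_subset_Ioc_right (cdf_le_one ν x))] at h3
  rw [h1, measure_congr h2, Real.volume_Ioc, sub_zero, ofReal_cdf]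

end ObsDriven

/-! ### Weighted distance and the fixed point theorem. -/

namespace ObsDriven

open Filter Topology ENNReal

variable {k : ℕ} {G : Fin k → Set ℝ}

/-- The weighted `ℓ¹` distance. -/
noncomputable def weightedEDist (w : Fin k → ℝ) (a b : (i : Fin k) → G i) : ℝ≥0∞ :=
  ∑ i, ENNReal.ofReal (w i) * edist (a i) (b i)

theorem weightedEDist_comm (w : Fin k → ℝ) (a b : (i : Fin k) → G i) :
    weightedEDist w a b = weightedEDist w b a := by
  simp only [weightedEDist, edist_comm]

theorem weightedEDist_triangle (w : Fin k → ℝ) (a b c : (i : Fin k) → G i) :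
    weightedEDist w a c ≤ weightedEDist w a b + weightedEDist w b c := by
  simp only [weightedEDist, ← Finset.sum_add_distrib, ← mul_add]
  gcongr
  exact edist_triangle _ _ _

theorem edist_le_weightedEDist {w : Fin k → ℝ} (hw : ∀ i, 1 ≤ w i) (a b : (i : Fin k) → G i) :
    edist a b ≤ weightedEDist w a b := by
  refine edist_pi_le_iff.2 fun i => ?_
  calc edist (a i) (b i) = 1 * edist (a i) (b i) := (one_mul _).symm
    _ ≤ ENNReal.ofReal (w i) * edist (a i) (b i) := by
      gcongr
      exact ENNReal.one_le_ofReal.2 (hw i)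
    _ ≤ weightedEDist w a b :=
      Finset.single_le_sum (f := fun i => ENNReal.ofReal (w i) * edist (a i) (b i))
        (fun _ _ => zero_le) (Finset.mem_univ i)

theorem eq_of_weightedEDist_eq_zero {w : Fin k → ℝ} (hw : ∀ i, 1 ≤ w i)
    {a b : (i : Fin k) → G i} (h : weightedEDist w a b = 0) : a = b :=
  edist_le_zero.1 ((edist_le_weightedEDist hw a b).trans h.le)

theorem weightedEDist_le_tsum (w : Fin k → ℝ) {f : ℕ → (i : Fin k) → G i}
    {a : (i : Fin k) → G i} (ha : Tendsto f atTop (𝓝 a)) (n : ℕ) :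
    weightedEDist w (f n) a ≤ ∑' m, weightedEDist w (f (n + m)) (f (n + m + 1)) := by
  simp only [weightedEDist]
  rw [Summable.tsum_finsetSum fun _ _ => ENNReal.summable]
  simp_rw [ENNReal.tsum_mul_left]
  gcongr with i
  exact edist_le_tsum_of_edist_le_of_tendsto _ (fun _ => le_rfl)
    ((continuous_apply i).continuousAt.tendsto.comp ha) n

@[fun_prop]
theorem measurable_weightedEDist {Q : Type*} [MeasurableSpace Q] (w : Fin k → ℝ)
    {W₁ W₂ : Q → (i : Fin k) → G i} (h₁ : Measurable W₁) (h₂ : Measurable W₂) :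
    Measurable fun q => weightedEDist w (W₁ q) (W₂ q) := by
  unfold weightedEDist
  refine Finset.measurable_sum _ fun i _ => Measurable.const_mul ?_ _
  exact ((measurable_pi_apply i).comp h₁).edist ((measurable_pi_apply i).comp h₂)

theorem le_pow_mul_of_le_mul {d : ℕ → ℝ≥0∞} {c : ℝ≥0∞} (h : ∀ n, d (n + 1) ≤ c * d n) (n : ℕ) :
    d n ≤ c ^ n * d 0 := by
  induction n with
  | zero => simp
  | succ n ih =>
    calc d (n + 1) ≤ c * d n := h n
      _ ≤ c * (c ^ n * d 0) := by gcongr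
      _ = c ^ (n + 1) * d 0 := by ring

/-- A map on measurable functions that contracts the integrated weighted distance has a fixed
point. -/
theorem exists_fixedPoint {Q : Type*} [MeasurableSpace Q] (π : Measure Q)
    (hG : ∀ i, IsClosed (G i)) {w : Fin k → ℝ} (hw : ∀ i, 1 ≤ w i) {c : ℝ≥0∞} (hc : c < 1)
    (T : (Q → (i : Fin k) → G i) → Q → (i : Fin k) → G i)
    (hT : ∀ W, Measurable W → Measurable (T W))
    (hcontr : ∀ W₁ W₂, Measurable W₁ → Measurable W₂ →
      ∫⁻ q, weightedEDist w (T W₁ q) (T W₂ q) ∂π ≤ c * ∫⁻ q, weightedEDist w (W₁ q) (W₂ q) ∂π)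
    {W₀ : Q → (i : Fin k) → G i} (hW₀ : Measurable W₀)
    (hfin : ∫⁻ q, weightedEDist w (W₀ q) (T W₀ q) ∂π ≠ ∞) :
    ∃ L : Q → (i : Fin k) → G i, Measurable L ∧ T L =ᵐ[π] L ∧
      ∫⁻ q, weightedEDist w (W₀ q) (L q) ∂π ≠ ∞ := by
  have : ∀ i, CompleteSpace (G i) := fun i => (hG i).completeSpace_coe
  set W : ℕ → Q → (i : Fin k) → G i := fun n => T^[n] W₀ with hW
  have hsucc : ∀ n, W (n + 1) = T (W n) := fun n => Function.iterate_succ_apply' T n W₀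
  have hWm : ∀ n, Measurable (W n) := by
    intro n
    induction n with
    | zero => exact hW₀
    | succ n ih => rw [hsucc]; exact hT _ ih
  set D : ℕ → ℝ≥0∞ := fun n => ∫⁻ q, weightedEDist w (W n q) (W (n + 1) q) ∂π with hD
  have hDle : ∀ n, D n ≤ c ^ n * D 0 := le_pow_mul_of_le_mul fun n => by
    simp only [hD]
    rw [hsucc (n + 1), hsucc n]
    exact hcontr _ _ (hWm n) (hT _ (hWm n))
  have hD0 : D 0 ≠ ∞ := hfin
  have hsum : ∑' n, D n ≠ ∞ := by
    refine ne_top_of_le_ne_top ?_ (ENNReal.tsum_le_tsum hDle)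
    rw [ENNReal.tsum_mul_right, ENNReal.tsum_geometric]
    exact ENNReal.mul_ne_top (ENNReal.inv_ne_top.2 (tsub_pos_of_lt hc).ne') hD0
  -- The integrated increments decay geometrically, so the total increment is integrable and the
  -- Picard iterates are Cauchy at almost every point.
  have hae : ∀ᵐ q ∂π, ∑' n, weightedEDist w (W n q) (W (n + 1) q) < ∞ := by
    refine ae_lt_top (Measurable.tsum fun n =>
      measurable_weightedEDist w (hWm n) (hWm (n + 1))) ?_
    rw [lintegral_tsum fun n => (measurable_weightedEDist w (hWm n) (hWm (n + 1))).aemeasurable]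
    exact hsum
  have hlim : ∀ᵐ q ∂π, ∃ l, Tendsto (fun n => W n q) atTop (𝓝 l) := by
    filter_upwards [hae] with q hq
    exact cauchySeq_tendsto_of_complete (cauchySeq_of_edist_le_of_tsum_ne_top _
      (fun n => edist_le_weightedEDist hw _ _) hq.ne)
  obtain ⟨L, hLm, hL⟩ :=
    measurable_limit_of_tendsto_metrizable_ae (fun n => (hWm n).aemeasurable) hlim
  have hWL : ∀ n, ∫⁻ q, weightedEDist w (W n q) (L q) ∂π ≤ ∑' m, D (n + m) := by
    intro n
    simp only [hD]
    rw [← lintegral_tsum fun m => (measurable_weightedEDist w (hWm _) (hWm _)).aemeasurable]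
    refine lintegral_mono_ae ?_
    filter_upwards [hL] with q hq
    exact weightedEDist_le_tsum w hq n
  have htail : Tendsto (fun n => ∑' m, D (n + m)) atTop (𝓝 0) := by
    simpa only [add_comm] using ENNReal.tendsto_sum_nat_add D hsum
  refine ⟨L, hLm, ?_, ne_top_of_le_ne_top (by simpa using hsum) (hWL 0)⟩
  -- Compare `T L` with `L` through `T (W n) = W (n + 1)`; both errors are tails of a convergent
  -- series.
  have hzero : ∫⁻ q, weightedEDist w (T L q) (L q) ∂π = 0 := by
    refine le_antisymm (le_of_tendsto_of_tendsto' tendsto_const_nhds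
      (?_ : Tendsto (fun n => ∑' m, D (n + m) + ∑' m, D (n + 1 + m)) atTop (𝓝 0)) fun n => ?_)
      zero_le
    · simpa using htail.add (htail.comp (tendsto_add_atTop_nat 1))
    · calc ∫⁻ q, weightedEDist w (T L q) (L q) ∂π
          ≤ ∫⁻ q, (weightedEDist w (T L q) (T (W n) q) + weightedEDist w (W (n + 1) q) (L q)) ∂π := by
            refine lintegral_mono fun q => ?_
            rw [hsucc]
            exact weightedEDist_triangle _ _ _ _
        _ = ∫⁻ q, weightedEDist w (T L q) (T (W n) q) ∂π +
            ∫⁻ q, weightedEDist w (W (n + 1) q) (L q) ∂π :=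
            lintegral_add_left (measurable_weightedEDist w (hT _ hLm) (hT _ (hWm n))) _
        _ ≤ _ := by
            refine add_le_add ?_ (hWL (n + 1))
            calc _ ≤ c * ∫⁻ q, weightedEDist w (L q) (W n q) ∂π := hcontr _ _ hLm (hWm n)
              _ ≤ 1 * ∫⁻ q, weightedEDist w (W n q) (L q) ∂π := by
                simp_rw [weightedEDist_comm w (L _)]
                gcongr
              _ ≤ _ := by rw [one_mul]; exact hWL n
  rw [lintegral_eq_zero_iff (measurable_weightedEDist w (hT _ hLm) hLm)] at hzero
  filter_upwards [hzero] with q hq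
  exact eq_of_weightedEDist_eq_zero hw hq

end ObsDriven

/-! ### Two-sided sequences, stationarity and factors. -/

namespace ObsDriven

section Sequences

/-- The translation by `t` on two-sided sequences. -/
def translate {S : Type*} (t : ℤ) (z : ℤ → S) : ℤ → S := fun s => z (s + t)

/-- The coordinates at negative times of a two-sided sequence. -/
def pastSeq {S : Type*} (z : ℤ → S) : ℕ → S := fun n => z (-1 - (n : ℤ))

theorem translate_zero {S : Type*} : translate (S := S) 0 = id := by
  funext z s
  simp [translate]

theorem pastSigma_mono {Ω S : Type*} [MeasurableSpace S] (Z : ℤ → Ω → S) {s t : ℤ}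
    (h : s ≤ t) : pastSigma Z s ≤ pastSigma Z t :=
  iSup_le fun r => le_iSup (fun s : {s : ℤ // s ≤ t} => MeasurableSpace.comap (Z s) inferInstance)
    ⟨r, r.2.trans h⟩

theorem measurable_pastSigma {Ω S : Type*} [MeasurableSpace S] (Z : ℤ → Ω → S) (t : ℤ) :
    Measurable[pastSigma Z t] (Z t) :=
  measurable_iff_comap_le.2
    (le_iSup (fun s : {s : ℤ // s ≤ t} => MeasurableSpace.comap (Z s) inferInstance) ⟨t, le_rfl⟩)

/-- Lets measurability with respect to `F_{t-1}` be exchanged for being a function of the past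
before `t`. -/
theorem comap_pastSeq {Ω S : Type*} [MeasurableSpace S] (Z : ℤ → Ω → S) (t : ℤ) :
    MeasurableSpace.comap (fun ω => pastSeq (translate t (path Z ω))) inferInstance =
      pastSigma Z (t - 1) := by
  apply le_antisymm
  · rw [← measurable_iff_comap_le]
    refine @measurable_pi_lambda _ _ _ (pastSigma Z (t - 1)) _ _ fun n => ?_
    rw [measurable_iff_comap_le]
    exact le_iSup (fun s : {s : ℤ // s ≤ t - 1} => MeasurableSpace.comap (Z s) inferInstance)
      ⟨-1 - (n : ℤ) + t, by omega⟩
  · refine iSup_le fun s => ?_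
    rw [← measurable_iff_comap_le]
    have h : Z s = fun ω => pastSeq (translate t (path Z ω)) (t - 1 - (s : ℤ)).toNat := by
      have hs := s.2
      have : -1 - (((t - 1 - (s : ℤ)).toNat : ℕ) : ℤ) + t = s := by omega
      funext ω
      simp only [pastSeq, translate, path, this]
    rw [h]
    exact (measurable_pi_apply (X := fun _ : ℕ => S) _).comp
      (comap_measurable fun ω => pastSeq (translate t (path Z ω)))

variable {S R : Type*} [MeasurableSpace S] [MeasurableSpace R]

@[fun_prop]
theorem measurable_translate (t : ℤ) : Measurable (translate (S := S) t) :=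
  measurable_pi_lambda _ fun _ => measurable_pi_apply _

@[fun_prop]
theorem measurable_shift : Measurable (shift (S := S)) := measurable_translate 1

@[fun_prop]
theorem measurable_pastSeq : Measurable (pastSeq (S := S)) :=
  measurable_pi_lambda _ fun _ => measurable_pi_apply _

/-- On two-sided sequences the shift is bijective, so its inverse preserves `ν` too, and so do all
integer powers. -/
theorem measurePreserving_translate {ν : Measure (ℤ → S)} (h : MeasurePreserving shift ν ν)
    (t : ℤ) : MeasurePreserving (translate t) ν ν := by
  have hinv : MeasurePreserving (translate (-1)) ν ν := by
    refine ⟨measurable_translate _, ?_⟩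
    nth_rewrite 1 [← h.map_eq]
    rw [Measure.map_map (measurable_translate _) measurable_shift]
    have : translate (-1) ∘ shift = (id : (ℤ → S) → ℤ → S) := by
      funext z s
      simp [translate, shift]
    rw [this, Measure.map_id]
  induction t using Int.induction_on with
  | zero => rw [translate_zero]; exact MeasurePreserving.id ν
  | succ n ih =>
    convert h.comp ih using 1
    funext z s
    simp only [translate, shift, Function.comp_apply]
    congr 1
    ring
  | pred n ih =>
    convert hinv.comp ih using 1
    funext z s
    simp only [translate, Function.comp_apply]
    congr 1
    ring

variable {Ω : Type*} [MeasurableSpace Ω] {μ : Measure Ω} {Z : ℤ → Ω → S}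

theorem measurable_path (hZ : ∀ t, Measurable (Z t)) : Measurable (path Z) :=
  measurable_pi_lambda _ hZ

theorem IsStationaryErgodic.isStationary (h : IsStationaryErgodic Z μ) : IsStationary Z μ :=
  ⟨h.1, h.2.toMeasurePreserving⟩

theorem IsStationary.measurePreserving_translate_path (h : IsStationary Z μ) (t : ℤ) :
    MeasurePreserving (fun ω => translate t (path Z ω)) μ (μ.map (path Z)) :=
  (measurePreserving_translate h.2 t).comp ⟨measurable_path h.1, rfl⟩

theorem IsStationary.map_eq (h : IsStationary Z μ) (t : ℤ) : μ.map (Z t) = μ.map (Z 0) := by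
  have key : ∀ t, μ.map (Z t) = (μ.map (path Z)).map (fun z => z 0) := fun t => by
    rw [← (h.measurePreserving_translate_path t).map_eq,
      Measure.map_map (measurable_pi_apply 0) (by have := measurable_path h.1; fun_prop)]
    congr 1
    funext ω
    simp [translate, path]
  rw [key t, key 0]

/-- Allows statements at every time `t` to be read under a single law of the past. -/
theorem IsStationary.measurePreserving_past (h : IsStationary Z μ) (t : ℤ) :
    MeasurePreserving (fun ω => pastSeq (translate t (path Z ω))) μ (μ.map (past Z)) := by
  have h1 : MeasurePreserving pastSeq (μ.map (path Z)) (μ.map (past Z)) :=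
    ⟨measurable_pastSeq, Measure.map_map measurable_pastSeq (measurable_path h.1)⟩
  exact h1.comp (h.measurePreserving_translate_path t)

/-- A factor of a stationary and ergodic process is stationary and ergodic. -/
theorem IsStationaryErgodic.factor (h : IsStationaryErgodic Z μ) {ψ : (ℤ → S) → R}
    (hψ : Measurable ψ) :
    IsStationaryErgodic (fun t ω => ψ (translate t (path Z ω))) μ := by
  have hp := measurable_path h.1
  have hm : ∀ t, Measurable fun ω => ψ (translate t (path Z ω)) := fun t => by fun_prop
  refine ⟨hm, ?_⟩
  set Ψ : (ℤ → S) → ℤ → R := fun z t => ψ (translate t z)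
  have hΨ : Measurable Ψ := measurable_pi_lambda _ fun t => by fun_prop
  have hmp : MeasurePreserving Ψ (μ.map (path Z))
      (μ.map (path fun t ω => ψ (translate t (path Z ω)))) :=
    ⟨hΨ, Measure.map_map hΨ hp⟩
  -- `Ψ` intertwines the two shifts, because translating `shift z` by `t` is translating `z` by `t +
  -- 1`.
  refine hmp.ergodic_of_ergodic_semiconj h.2 measurable_shift fun z => ?_
  funext t
  simp only [Ψ, shift]
  congr 1
  funext s
  simp only [translate, shift]
  congr 1
  ring

end Sequences

/-! ### Integrability and finite weighted distance. -/

section Integrability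

open scoped ENNReal

variable {k : ℕ} {G : Fin k → Set ℝ} {Ω : Type*} [MeasurableSpace Ω] {μ : Measure Ω}

theorem edist_coe_eq_enorm_sub {A : Set ℝ} (a b : A) : edist a b = ‖(a : ℝ) - b‖ₑ := by
  rw [Subtype.edist_eq, edist_eq_enorm_sub]

theorem integrable_sum_abs_iff {f : Fin k → Ω → ℝ} (hf : ∀ i, Measurable (f i)) :
    Integrable (fun ω => ∑ i, |f i ω|) μ ↔ ∀ i, Integrable (f i) μ := by
  refine ⟨fun h i => h.mono (hf i).aestronglyMeasurable (ae_of_all _ fun ω => ?_),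
    fun h => integrable_finsetSum _ fun i _ => (h i).abs⟩
  rw [Real.norm_eq_abs, Real.norm_eq_abs]
  exact (Finset.single_le_sum (f := fun i => |f i ω|) (fun _ _ => abs_nonneg _)
    (Finset.mem_univ i)).trans (le_abs_self _)

theorem lintegral_weightedEDist_ne_top [IsFiniteMeasure μ] (w : Fin k → ℝ)
    (s : (i : Fin k) → G i) {V : Ω → (i : Fin k) → G i} (hV : Measurable V)
    (hint : ∀ i, Integrable (fun ω => (V ω i : ℝ)) μ) :
    ∫⁻ ω, weightedEDist w s (V ω) ∂μ ≠ ∞ := by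
  simp only [weightedEDist]
  rw [lintegral_finsetSum _ fun i _ => by fun_prop]
  refine ENNReal.sum_ne_top.2 fun i _ => ?_
  rw [lintegral_const_mul _ (by fun_prop)]
  refine ENNReal.mul_ne_top ENNReal.ofReal_ne_top ?_
  simp_rw [edist_coe_eq_enorm_sub]
  exact ((integrable_const (s i : ℝ)).sub (hint i)).hasFiniteIntegral.ne

theorem integrable_of_lintegral_weightedEDist_ne_top [IsFiniteMeasure μ] {w : Fin k → ℝ}
    (hw : ∀ i, 1 ≤ w i) (s : (i : Fin k) → G i) {V : Ω → (i : Fin k) → G i} (hV : Measurable V)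
    (hfin : ∫⁻ ω, weightedEDist w s (V ω) ∂μ ≠ ∞) (i : Fin k) :
    Integrable (fun ω => (V ω i : ℝ)) μ := by
  have h : Integrable (fun ω => (s i : ℝ) - V ω i) μ := by
    refine ⟨by fun_prop, lt_of_le_of_lt (lintegral_mono fun ω => ?_) hfin.lt_top⟩
    rw [← edist_coe_eq_enorm_sub]
    exact (edist_le_pi_edist _ _ i).trans (edist_le_weightedEDist hw _ _)
  exact ((integrable_const (s i : ℝ)).sub h).congr (ae_of_all _ fun ω => by simp)

end Integrability

end ObsDriven

/-! ### One step of the recursion. -/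

namespace ObsDriven

section Step

open scoped ENNReal

/-- The retraction of the line onto itself or onto the half-line. -/
noncomputable def retract {A : Set ℝ} (hA : A = Set.univ ∨ A = Set.Ici 0) (x : ℝ) : A :=
  ⟨max x (if A = Set.univ then x else 0), by
    split_ifs with h
    · rw [h]; trivial
    · rw [hA.resolve_left h]; exact le_max_right x 0⟩

theorem retract_of_mem {A : Set ℝ} (hA : A = Set.univ ∨ A = Set.Ici 0) {x : ℝ} (hx : x ∈ A) :
    (retract hA x : ℝ) = x := by
  simp only [retract]
  split_ifs with h
  · exact max_self x
  · rw [hA.resolve_left h] at hx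
    exact max_eq_left hx

/-- `g` is only known to land in `G` for observations in `E`; retracting makes the step total, and
being 1-Lipschitz it preserves the contraction bound. -/
theorem abs_retract_sub_le {A : Set ℝ} (hA : A = Set.univ ∨ A = Set.Ici 0) (x y : ℝ) :
    |(retract hA x : ℝ) - retract hA y| ≤ |x - y| := by
  simp only [retract]
  split_ifs with h
  · simp
  · exact abs_max_sub_max_le_abs x y 0

theorem abs_retract_le {A : Set ℝ} (hA : A = Set.univ ∨ A = Set.Ici 0) (x : ℝ) :
    |(retract hA x : ℝ)| ≤ |x| := by
  simp only [retract]
  split_ifs with h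
  · simp
  · simpa using abs_max_sub_max_le_abs x 0 0

theorem measurable_retract {A : Set ℝ} (hA : A = Set.univ ∨ A = Set.Ici 0) :
    Measurable (retract hA) := by
  refine Measurable.subtype_mk ?_
  split_ifs <;> fun_prop

variable {k m : ℕ} {G : Fin k → Set ℝ} (hG : ∀ i, G i = Set.univ ∨ G i = Set.Ici 0)
  (P : (i : Fin k) → Kernel (G i) ℝ)
  (g : ((i : Fin k) → G i) → (Fin k → ℝ) → (Fin m → ℝ) → Fin k → ℝ)

/-- One step of the latent recursion, retracted to the parameter set. -/
noncomputable def step (s : (i : Fin k) → G i) (z : (Fin k → ℝ) × (Fin m → ℝ)) :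
    (i : Fin k) → G i :=
  fun i => retract (hG i) (g s (quantileVec P s z.1) z.2 i)

/-- The action of the latent recursion on functions of the past. -/
noncomputable def update (W : (ℕ → (Fin k → ℝ) × (Fin m → ℝ)) → (i : Fin k) → G i)
    (q : ℕ → (Fin k → ℝ) × (Fin m → ℝ)) : (i : Fin k) → G i :=
  step hG P g (W fun n => q (n + 1)) (q 0)

theorem measurable_quantileVec [∀ i, IsMarkovKernel (P i)] :
    Measurable fun p : ((i : Fin k) → G i) × (Fin k → ℝ) => quantileVec P p.1 p.2 :=
  measurable_pi_lambda _ fun i => by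
    have h : Measurable fun p : ((i : Fin k) → G i) × (Fin k → ℝ) => (p.1 i, p.2 i) := by
      fun_prop
    exact (measurable_quantile (P i)).comp h

variable {P g}

theorem measurable_update_map [∀ i, IsMarkovKernel (P i)]
    (hg : Measurable
      (fun p : ((i : Fin k) → G i) × (Fin k → ℝ) × (Fin m → ℝ) => g p.1 p.2.1 p.2.2)) :
    Measurable fun p : ((i : Fin k) → G i) × (Fin k → ℝ) × (Fin m → ℝ) =>
      g p.1 (quantileVec P p.1 p.2.1) p.2.2 :=
  hg.comp (measurable_fst.prodMk (((measurable_quantileVec P).comp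
    (measurable_fst.prodMk (measurable_fst.comp measurable_snd))).prodMk
      (measurable_snd.comp measurable_snd)))

theorem measurable_step [∀ i, IsMarkovKernel (P i)]
    (hg : Measurable
      (fun p : ((i : Fin k) → G i) × (Fin k → ℝ) × (Fin m → ℝ) => g p.1 p.2.1 p.2.2)) :
    Measurable fun p : ((i : Fin k) → G i) × (Fin k → ℝ) × (Fin m → ℝ) => step hG P g p.1 p.2 :=
  measurable_pi_lambda _ fun i => (measurable_retract (hG i)).comp
    ((measurable_pi_apply i).comp (measurable_update_map hg))

theorem measurable_update [∀ i, IsMarkovKernel (P i)]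
    (hg : Measurable
      (fun p : ((i : Fin k) → G i) × (Fin k → ℝ) × (Fin m → ℝ) => g p.1 p.2.1 p.2.2))
    {W : (ℕ → (Fin k → ℝ) × (Fin m → ℝ)) → (i : Fin k) → G i} (hW : Measurable W) :
    Measurable (update hG P g W) :=
  (measurable_step hG hg).comp ((hW.comp (measurable_pi_lambda _ fun n =>
    measurable_pi_apply (n + 1))).prodMk (measurable_pi_apply 0))

theorem edist_eq_ofReal_abs_sub {A : Set ℝ} (a b : A) :
    edist a b = ENNReal.ofReal |(a : ℝ) - b| := by
  rw [Subtype.edist_eq, edist_dist, Real.dist_eq]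

theorem weightedEDist_eq_ofReal {w : Fin k → ℝ} (hw : ∀ i, 0 ≤ w i) (a b : (i : Fin k) → G i) :
    weightedEDist w a b = ENNReal.ofReal (∑ i, w i * |(a i : ℝ) - b i|) := by
  rw [ENNReal.ofReal_sum_of_nonneg fun i _ => mul_nonneg (hw i) (abs_nonneg _)]
  simp only [weightedEDist]
  refine Finset.sum_congr rfl fun i _ => ?_
  rw [ENNReal.ofReal_mul (hw i), edist_eq_ofReal_abs_sub]

/-- The coordinatewise contraction bound implies a bound in the weighted distance. -/
theorem lintegral_weightedEDist_step_le [∀ i, IsMarkovKernel (P i)]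
    (hg : Measurable
      (fun p : ((i : Fin k) → G i) × (Fin k → ℝ) × (Fin m → ℝ) => g p.1 p.2.1 p.2.2))
    {H : Matrix (Fin k) (Fin k) ℝ} (hH : ∀ i j, 0 ≤ H i j) {w : Fin k → ℝ} {c : ℝ}
    (hw : ∀ i, 0 ≤ w i) (hc : 0 ≤ c) (hwH : ∀ j, ∑ i, w i * H i j ≤ c * w j)
    (η : Measure ((Fin k → ℝ) × (Fin m → ℝ))) (s₁ s₂ : (i : Fin k) → G i)
    (h : ∀ i, ∫⁻ z, ENNReal.ofReal
        |g s₁ (quantileVec P s₁ z.1) z.2 i - g s₂ (quantileVec P s₂ z.1) z.2 i| ∂η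
      ≤ ENNReal.ofReal (∑ j, H i j * |(s₁ j : ℝ) - (s₂ j : ℝ)|)) :
    ∫⁻ z, weightedEDist w (step hG P g s₁ z) (step hG P g s₂ z) ∂η ≤
      ENNReal.ofReal c * weightedEDist w s₁ s₂ := by
  have hm : ∀ s, Measurable fun z : (Fin k → ℝ) × (Fin m → ℝ) => step hG P g s z := fun s =>
    (measurable_step hG hg).comp measurable_prodMk_left
  have hmi : ∀ s i, Measurable fun z : (Fin k → ℝ) × (Fin m → ℝ) => step hG P g s z i :=
    fun s i => (measurable_pi_apply i).comp (hm s)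
  have hnn : ∀ i, 0 ≤ ∑ j, H i j * |(s₁ j : ℝ) - (s₂ j : ℝ)| := fun i =>
    Finset.sum_nonneg fun j _ => mul_nonneg (hH i j) (abs_nonneg _)
  calc ∫⁻ z, weightedEDist w (step hG P g s₁ z) (step hG P g s₂ z) ∂η
      = ∑ i, ENNReal.ofReal (w i) *
          ∫⁻ z, edist (step hG P g s₁ z i) (step hG P g s₂ z i) ∂η := by
        simp only [weightedEDist]
        rw [lintegral_finsetSum _ fun i _ => ((hmi s₁ i).edist (hmi s₂ i)).const_mul _]
        exact Finset.sum_congr rfl fun i _ =>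
          lintegral_const_mul _ ((hmi s₁ i).edist (hmi s₂ i))
    _ ≤ ∑ i, ENNReal.ofReal (w i) *
          ENNReal.ofReal (∑ j, H i j * |(s₁ j : ℝ) - (s₂ j : ℝ)|) := by
        gcongr with i
        refine (lintegral_mono fun z => ?_).trans (h i)
        rw [edist_eq_ofReal_abs_sub]
        exact ENNReal.ofReal_le_ofReal (abs_retract_sub_le (hG i) _ _)
    _ = ENNReal.ofReal (∑ i, w i * ∑ j, H i j * |(s₁ j : ℝ) - (s₂ j : ℝ)|) := by
        rw [ENNReal.ofReal_sum_of_nonneg fun i _ => mul_nonneg (hw i) (hnn i)]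
        exact Finset.sum_congr rfl fun i _ => (ENNReal.ofReal_mul (hw i)).symm
    _ ≤ ENNReal.ofReal (c * ∑ j, w j * |(s₁ j : ℝ) - (s₂ j : ℝ)|) := by
        refine ENNReal.ofReal_le_ofReal ?_
        -- Exchanging the sums exposes the column sums `∑ i, w i * H i j`, to which `hwH` applies.
        simp only [Finset.mul_sum]
        rw [Finset.sum_comm]
        refine Finset.sum_le_sum fun j _ => ?_
        calc ∑ i, w i * (H i j * |(s₁ j : ℝ) - (s₂ j : ℝ)|)
            = (∑ i, w i * H i j) * |(s₁ j : ℝ) - (s₂ j : ℝ)| := by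
              rw [Finset.sum_mul]
              exact Finset.sum_congr rfl fun i _ => by ring
          _ ≤ (c * w j) * |(s₁ j : ℝ) - (s₂ j : ℝ)| :=
              mul_le_mul_of_nonneg_right (hwH j) (abs_nonneg _)
          _ = c * (w j * |(s₁ j : ℝ) - (s₂ j : ℝ)|) := by ring
    _ = ENNReal.ofReal c * weightedEDist w s₁ s₂ := by
        rw [ENNReal.ofReal_mul hc, weightedEDist_eq_ofReal hw]

end Step

/-! ### The recursion along the past inputs. -/

section Recursion

open scoped ENNReal

variable {Ω : Type*} [MeasurableSpace Ω] {μ : Measure Ω} {k m : ℕ}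
  {G : Fin k → Set ℝ} (hG : ∀ i, G i = Set.univ ∨ G i = Set.Ici 0)
  {P : (i : Fin k) → Kernel (G i) ℝ}
  {g : ((i : Fin k) → G i) → (Fin k → ℝ) → (Fin m → ℝ) → Fin k → ℝ}
  {U : ℤ → Ω → Fin k → ℝ} {X : ℤ → Ω → Fin m → ℝ}

/-- The past before `t + 1` has head `z t` and tail the past before `t`, so a fixed point of
`update` solves the recursion. -/
theorem update_pastSeq (W : (ℕ → (Fin k → ℝ) × (Fin m → ℝ)) → (i : Fin k) → G i) (t : ℤ)
    (z : ℤ → (Fin k → ℝ) × (Fin m → ℝ)) :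
    update hG P g W (pastSeq (translate (t + 1) z)) =
      step hG P g (W (pastSeq (translate t z))) (z t) := by
  simp only [update, pastSeq, translate]
  congr 2
  · funext n
    congr 1
    push_cast
    ring
  · push_cast
    ring_nf

/-- Disintegrate the law of `(past Z, Z 0)`: for a fixed past, `W₁` and `W₂` are constants and the
conditional bound applies to them. -/
theorem lintegral_update_le [IsFiniteMeasure μ] [∀ i, IsMarkovKernel (P i)]
    (hg : Measurable
      (fun p : ((i : Fin k) → G i) × (Fin k → ℝ) × (Fin m → ℝ) => g p.1 p.2.1 p.2.2))
    (hst : IsStationary (inputs U X) μ) {H : Matrix (Fin k) (Fin k) ℝ} (hH : ∀ i j, 0 ≤ H i j)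
    {w : Fin k → ℝ} {c : ℝ} (hw : ∀ i, 0 ≤ w i) (hc : 0 ≤ c)
    (hwH : ∀ j, ∑ i, w i * H i j ≤ c * w j)
    (hcontr : ∀ᵐ ω ∂μ, ∀ s₁ s₂ : (i : Fin k) → G i, ∀ i : Fin k,
      ∫⁻ z, ENNReal.ofReal
          |g s₁ (quantileVec P s₁ z.1) z.2 i - g s₂ (quantileVec P s₂ z.1) z.2 i|
          ∂(condLaw (inputs U X) μ ω)
        ≤ ENNReal.ofReal (∑ j, H i j * |(s₁ j : ℝ) - (s₂ j : ℝ)|))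
    {W₁ W₂ : (ℕ → (Fin k → ℝ) × (Fin m → ℝ)) → (i : Fin k) → G i}
    (hW₁ : Measurable W₁) (hW₂ : Measurable W₂) :
    ∫⁻ q, weightedEDist w (update hG P g W₁ q) (update hG P g W₂ q) ∂(μ.map (past (inputs U X)))
      ≤ ENNReal.ofReal c *
        ∫⁻ q, weightedEDist w (W₁ q) (W₂ q) ∂(μ.map (past (inputs U X))) := by
  set Z := inputs U X with hZ
  have hpast : Measurable (past Z) := measurable_pi_lambda _ fun n => hst.1 _
  set f : (ℕ → (Fin k → ℝ) × (Fin m → ℝ)) × ((Fin k → ℝ) × (Fin m → ℝ)) → ℝ≥0∞ :=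
    fun p => weightedEDist w (step hG P g (W₁ p.1) p.2) (step hG P g (W₂ p.1) p.2) with hf
  have hstep : ∀ W : (ℕ → (Fin k → ℝ) × (Fin m → ℝ)) → (i : Fin k) → G i, Measurable W →
      Measurable fun p : (ℕ → (Fin k → ℝ) × (Fin m → ℝ)) × ((Fin k → ℝ) × (Fin m → ℝ)) =>
        step hG P g (W p.1) p.2 := fun W hW =>
    (measurable_step hG hg).comp ((hW.comp measurable_fst).prodMk measurable_snd)
  have hfm : Measurable f := measurable_weightedEDist w (hstep _ hW₁) (hstep _ hW₂)
  have hWm : Measurable fun q => weightedEDist w (W₁ q) (W₂ q) :=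
    measurable_weightedEDist w hW₁ hW₂
  calc ∫⁻ q, weightedEDist w (update hG P g W₁ q) (update hG P g W₂ q) ∂(μ.map (past Z))
      = ∫⁻ ω, f (past Z ω, Z 0 ω) ∂μ := by
        -- By stationarity the past before time `1` has the same law, and its newest entry is `Z 0`.
        have hmp := hst.measurePreserving_past (0 + 1)
        rw [← hmp.lintegral_comp (measurable_weightedEDist w
          (measurable_update hG hg hW₁) (measurable_update hG hg hW₂))]
        refine lintegral_congr fun ω => ?_
        rw [update_pastSeq, update_pastSeq, translate_zero, id]
        rfl
    _ = ∫⁻ p, f p ∂(μ.map (past Z) ⊗ₘ condDistrib (Z 0) (past Z) μ) := by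
        rw [compProd_map_condDistrib (hst.1 0).aemeasurable,
          lintegral_map hfm (hpast.prodMk (hst.1 0))]
    _ = ∫⁻ ω, ∫⁻ z, f (past Z ω, z) ∂(condLaw Z μ ω) ∂μ := by
        rw [Measure.lintegral_compProd hfm, lintegral_map hfm.lintegral_kernel_prod_right' hpast]
        rfl
    _ ≤ ∫⁻ ω, ENNReal.ofReal c * weightedEDist w (W₁ (past Z ω)) (W₂ (past Z ω)) ∂μ := by
        refine lintegral_mono_ae ?_
        filter_upwards [hcontr] with ω hω
        exact lintegral_weightedEDist_step_le hG hg hH hw hc hwH (condLaw Z μ ω)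
          (W₁ (past Z ω)) (W₂ (past Z ω)) (hω (W₁ (past Z ω)) (W₂ (past Z ω)))
    _ = _ := by
        rw [lintegral_map hWm hpast]
        exact lintegral_const_mul _ (hWm.comp hpast)

/-- A quantile of a law that depends on the past, at an independent uniform level, lies in every
set that carries all the laws. -/
theorem ae_quantileVec_mem [IsProbabilityMeasure μ] [∀ i, IsMarkovKernel (P i)] {E : Fin k → Set ℝ}
    (hE : ∀ i, MeasurableSet (E i)) (hPE : ∀ i (s : G i), P i s (E i) = 1)
    (hU : ∀ i, μ.map (fun ω => U 0 ω i) = (volume : Measure ℝ).restrict (Set.Icc 0 1))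
    (h1 : InputAssumption U X μ)
    {L : (ℕ → (Fin k → ℝ) × (Fin m → ℝ)) → (i : Fin k) → G i} (hL : Measurable L) (t : ℤ) :
    ∀ᵐ ω ∂μ, ∀ i,
      quantileVec P (L (pastSeq (translate t (path (inputs U X) ω)))) (U t ω) i ∈ E i := by
  refine ae_all_iff.2 fun i => ?_
  have hst := h1.1.isStationary
  set Z := inputs U X with hZ
  have hpast : Measurable (past Z) := measurable_pi_lambda _ fun n => hst.1 _
  have hUm : Measurable (U 0) := measurable_fst.comp (hst.1 0)
  have hUi : Measurable fun ω => U 0 ω i := (measurable_pi_apply i).comp hUm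
  have hA : MeasurableSet {p : (ℕ → (Fin k → ℝ) × (Fin m → ℝ)) × ℝ |
      quantile (P i (L p.1 i)) p.2 ∈ E i} :=
    ((measurable_quantile (P i)).comp ((((measurable_pi_apply i).comp hL).comp
      measurable_fst).prodMk measurable_snd)) (hE i)
  have hB : MeasurableSet {z : ℤ → (Fin k → ℝ) × (Fin m → ℝ) |
      quantile (P i (L (pastSeq z) i)) ((z 0).1 i) ∈ E i} := by
    have : Measurable fun z : ℤ → (Fin k → ℝ) × (Fin m → ℝ) => (pastSeq z, (z 0).1 i) :=
      measurable_pastSeq.prodMk ((measurable_pi_apply i).comp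
        (measurable_fst.comp (measurable_pi_apply 0)))
    exact this hA
  have hind : IndepFun (past Z) (fun ω => U 0 ω i) μ := by
    have h : IndepFun (past Z) (U 0) μ := by
      rw [IndepFun_iff_Indep, comap_past]
      exact (h1.2 0).symm
    exact h.comp measurable_id (measurable_pi_apply i)
  have hzero : ∀ᵐ ω ∂μ, quantile (P i (L (past Z ω) i)) (U 0 ω i) ∈ E i := by
    -- By independence the joint law is a product, so Fubini freezes the past; the quantile at a
    -- uniform level then has law `P i (L q i)`, carried by `E i`.
    have hlaw := (indepFun_iff_map_prod_eq_prod_map_map hpast.aemeasurable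
      hUi.aemeasurable).1 hind
    rw [← ae_map_iff (p := fun p : (ℕ → (Fin k → ℝ) × (Fin m → ℝ)) × ℝ =>
      quantile (P i (L p.1 i)) p.2 ∈ E i) (hpast.prodMk hUi).aemeasurable hA, hlaw, hU i,
      Measure.ae_prod_iff_ae_ae hA]
    refine ae_of_all _ fun q => ?_
    have hq : Measurable (quantile (P i (L q i))) :=
      (measurable_quantile (P i)).comp measurable_prodMk_left
    rw [← ae_map_iff (p := fun y => y ∈ E i) hq.aemeasurable (hE i), map_quantile_uniform]
    exact (prob_compl_eq_zero_iff (hE i)).2 (hPE i _)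
  have hν : ∀ᵐ z ∂(μ.map (path Z)), quantile (P i (L (pastSeq z) i)) ((z 0).1 i) ∈ E i :=
    (ae_map_iff (measurable_path hst.1).aemeasurable hB).2 hzero
  have ht := (hst.measurePreserving_translate_path t).quasiMeasurePreserving.ae hν
  filter_upwards [ht] with ω hω
  simpa [translate, path, hZ, inputs, quantileVec] using hω

/-- The latent variables of a solution are functions of the past inputs. -/
theorem IsStationarySolution.exists_eq_past [∀ i, IsMarkovKernel (P i)]
    (hg : Measurable
      (fun p : ((i : Fin k) → G i) × (Fin k → ℝ) × (Fin m → ℝ) => g p.1 p.2.1 p.2.2))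
    {E : Fin k → Set ℝ} {Y : ℤ → Ω → Fin k → ℝ} {lam : ℤ → Ω → (i : Fin k) → G i}
    (h : IsStationarySolution E P g U X μ Y lam) :
    (∀ t, ∀ᵐ ω ∂μ, lam (t + 1) ω = step hG P g (lam t ω) (inputs U X t ω)) ∧
    ∀ t, ∃ W : (ℕ → (Fin k → ℝ) × (Fin m → ℝ)) → (i : Fin k) → G i, Measurable W ∧
      ∀ᵐ ω ∂μ, lam t ω = W (pastSeq (translate t (path (inputs U X) ω))) := by
  have hrec : ∀ t, ∀ᵐ ω ∂μ, lam (t + 1) ω = step hG P g (lam t ω) (inputs U X t ω) := by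
    intro t
    filter_upwards [h.latent_eq (t + 1), h.observation_eq t] with ω h1 h2
    rw [add_sub_cancel_right] at h1
    funext i
    apply Subtype.ext
    -- The value of `g` is a value of `lam`, so the retraction acts trivially on it.
    have hmem : g (lam t ω) (Y t ω) (X t ω) i ∈ G i := h1 i ▸ (lam (t + 1) ω i).2
    rw [h2] at hmem
    rw [h1 i, h2]
    exact (retract_of_mem (hG i) hmem).symm
  refine ⟨hrec, fun t => ?_⟩
  rcases isEmpty_or_nonempty Ω with hΩ | ⟨⟨ω₀⟩⟩
  · have hz : μ = 0 := Measure.eq_zero_of_isEmpty μ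
    exact ⟨fun _ i => retract (hG i) 0, measurable_const, by simp [hz]⟩
  have : ∀ i, StandardBorelSpace (G i) := fun i => by
    have : MeasurableSet (G i) := by
      rcases hG i with h | h <;> rw [h]
      · exact MeasurableSet.univ
      · exact measurableSet_Ici
    exact this.standardBorel
  have : Nonempty ((i : Fin k) → G i) := ⟨lam 0 ω₀⟩
  -- Adaptedness gives only `F_t`-measurability of `lam t`; the right side of the recursion is
  -- `F_{t-1}`-measurable, and Doob–Dynkin factors it through the past.
  have hmeas : Measurable[MeasurableSpace.comap
      (fun ω => pastSeq (translate t (path (inputs U X) ω))) inferInstance]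
      fun ω => step hG P g (lam (t - 1) ω) (inputs U X (t - 1) ω) := by
    rw [comap_pastSeq]
    exact (measurable_step hG hg).comp
      ((h.adapted_lam (t - 1)).prodMk (measurable_pastSigma (inputs U X) (t - 1)))
  obtain ⟨W, hW, hWeq⟩ := hmeas.exists_eq_measurable_comp
  refine ⟨W, hW, ?_⟩
  filter_upwards [hrec (t - 1)] with ω hω
  rw [sub_add_cancel] at hω
  rw [hω]
  exact congrFun hWeq ω

end Recursion

end ObsDriven

/-! ### Existence, uniqueness and ergodicity. -/

theorem mainTheorem2 {Ω : Type*} [MeasurableSpace Ω] (μ : Measure Ω) [IsProbabilityMeasure μ]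
    (k m : ℕ)
    -- parameter sets and state spaces
    (G E : Fin k → Set ℝ) (hG : ∀ i, G i = Set.univ ∨ G i = Set.Ici 0)
    (hE : ∀ i, MeasurableSet (E i))
    -- the marginal distributions `P_i(· | s_i)` on `E_i`
    (P : (i : Fin k) → Kernel (G i) ℝ) (hP : ∀ i, IsMarkovKernel (P i))
    (hPE : ∀ i (s : G i), P i s (E i) = 1)
    -- the update function, a measurable map from `G × E × ℝ^m` to `G`
    -- (its values at `y` outside `E` are immaterial)
    (g : ((i : Fin k) → G i) → (Fin k → ℝ) → (Fin m → ℝ) → Fin k → ℝ)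
    (hg : Measurable
      (fun p : ((i : Fin k) → G i) × (Fin k → ℝ) × (Fin m → ℝ) => g p.1 p.2.1 p.2.2))
    (hgG : ∀ s y x, (∀ i, y i ∈ E i) → ∀ i, g s y x i ∈ G i)
    (U : ℤ → Ω → Fin k → ℝ) (X : ℤ → Ω → Fin m → ℝ)
    -- the law of `U_0` is a copula
    (hU : ∀ i, μ.map (fun ω => U 0 ω i) = (volume : Measure ℝ).restrict (Set.Icc 0 1))
    (h1 : ObsDriven.InputAssumption U X μ)
    (h2 : ObsDriven.IntegrabilityAssumption P g U X μ)
    (h3 : ObsDriven.ContractionAssumption P g U X μ) :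
    ∃ (Y : ℤ → Ω → Fin k → ℝ) (lam : ℤ → Ω → (i : Fin k) → G i),
      ObsDriven.IsStationarySolution E P g U X μ Y lam ∧
      (∀ (Y' : ℤ → Ω → Fin k → ℝ) (lam' : ℤ → Ω → (i : Fin k) → G i),
        ObsDriven.IsStationarySolution E P g U X μ Y' lam' →
          ∀ᵐ ω ∂μ, ∀ t, Y' t ω = Y t ω ∧ lam' t ω = lam t ω) ∧
      ObsDriven.IsStationaryErgodic (fun t ω => (Y t ω, lam t ω, X t ω)) μ := by
  have hst := h1.1.isStationary
  set Z := ObsDriven.inputs U X with hZ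
  have hpast : Measurable (ObsDriven.past Z) := measurable_pi_lambda _ fun n => hst.1 _
  set π := μ.map (ObsDriven.past Z) with hπ
  have hπp : IsProbabilityMeasure π := Measure.isProbabilityMeasure_map hpast.aemeasurable
  have hmp : ∀ t, MeasurePreserving
      (fun ω => ObsDriven.pastSeq (ObsDriven.translate t (ObsDriven.path Z ω))) μ π :=
    fun t => hst.measurePreserving_past t
  obtain ⟨H, hH, hHs, hcond⟩ := h3
  obtain ⟨s, hs⟩ := h2
  obtain ⟨w, c, hw, hc0, hc1, hwH⟩ := ObsDriven.exists_weights H hH hHs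
  have hw0 : ∀ i, 0 ≤ w i := fun i => zero_le_one.trans (hw i)
  have hc1' : ENNReal.ofReal c < 1 := ENNReal.ofReal_lt_one.2 hc1
  have hcontr := fun (W₁ W₂ : (ℕ → (Fin k → ℝ) × (Fin m → ℝ)) → (i : Fin k) → G i)
      (h₁ : Measurable W₁) (h₂ : Measurable W₂) =>
    ObsDriven.lintegral_update_le hG hg hst hH hw0 hc0 hwH hcond h₁ h₂
  -- The Picard iteration starts from the constant `s` of A2, whose first increment is integrable.
  have hstart : ∫⁻ q, ObsDriven.weightedEDist w s
      (ObsDriven.update hG P g (fun _ => s) q) ∂π ≠ ⊤ := by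
    have hgm : Measurable fun ω => g s (ObsDriven.quantileVec P s (U 0 ω)) (X 0 ω) :=
      (ObsDriven.measurable_update_map hg).comp (measurable_prodMk_left.comp (hst.1 0))
    have hstepm : Measurable fun ω => ObsDriven.step hG P g s (Z 0 ω) :=
      (ObsDriven.measurable_step hG hg).comp (measurable_prodMk_left.comp (hst.1 0))
    have hgi := (ObsDriven.integrable_sum_abs_iff fun i => (measurable_pi_apply i).comp hgm).1 hs
    have hfin := ObsDriven.lintegral_weightedEDist_ne_top w s hstepm fun i =>
      (hgi i).mono
        (measurable_subtype_coe.comp ((measurable_pi_apply i).comp hstepm)).aestronglyMeasurable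
        (ae_of_all _ fun ω => ObsDriven.abs_retract_le (hG i) _)
    rw [← (hmp (0 + 1)).lintegral_comp (ObsDriven.measurable_weightedEDist w measurable_const
      (ObsDriven.measurable_update hG hg measurable_const))]
    simp only [ObsDriven.update_pastSeq]
    exact hfin
  have hclosed : ∀ i, IsClosed (G i) := fun i => by
    rcases hG i with h | h <;> rw [h]
    · exact isClosed_univ
    · exact isClosed_Ici
  obtain ⟨L, hL, hfix, hLfin⟩ := ObsDriven.exists_fixedPoint π hclosed hw hc1'
    (ObsDriven.update hG P g) (fun W hW => ObsDriven.measurable_update hG hg hW) hcontr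
    (measurable_const (a := s)) hstart
  have hpastm : ∀ t, Measurable[ObsDriven.pastSigma Z (t - 1)]
      fun ω => L (ObsDriven.pastSeq (ObsDriven.translate t (ObsDriven.path Z ω))) := fun t => by
    rw [← ObsDriven.comap_pastSeq]
    exact hL.comp (comap_measurable _)
  set lam : ℤ → Ω → (i : Fin k) → G i := fun t ω =>
    L (ObsDriven.pastSeq (ObsDriven.translate t (ObsDriven.path Z ω))) with hlam
  set Y : ℤ → Ω → Fin k → ℝ := fun t ω => ObsDriven.quantileVec P (lam t ω) (U t ω) with hY
  have hadapt : ∀ t, Measurable[ObsDriven.pastSigma Z t] (lam t) := fun t =>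
    (hpastm t).mono (ObsDriven.pastSigma_mono Z (by omega)) le_rfl
  have hE' : ∀ t, ∀ᵐ ω ∂μ, ∀ i, Y t ω i ∈ E i := ObsDriven.ae_quantileVec_mem hE hPE hU h1 hL
  have hrec : ∀ t, ∀ᵐ ω ∂μ, lam (t + 1) ω = ObsDriven.step hG P g (lam t ω) (Z t ω) := by
    intro t
    filter_upwards [(hmp (t + 1)).quasiMeasurePreserving.ae hfix] with ω hω
    rw [ObsDriven.update_pastSeq] at hω
    exact hω.symm
  have hlamint : ∀ t i, Integrable (fun ω => (lam t ω i : ℝ)) μ := by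
    intro t
    refine ObsDriven.integrable_of_lintegral_weightedEDist_ne_top hw s
      (hL.comp (hmp t).measurable) ?_
    rwa [← (hmp t).lintegral_comp (ObsDriven.measurable_weightedEDist w measurable_const hL)]
      at hLfin
  have hψ : Measurable fun z : ℤ → (Fin k → ℝ) × (Fin m → ℝ) =>
      (ObsDriven.quantileVec P (L (ObsDriven.pastSeq z)) (z 0).1, L (ObsDriven.pastSeq z),
        (z 0).2) := by
    have h := hL.comp ObsDriven.measurable_pastSeq
    have h' : Measurable fun z : ℤ → (Fin k → ℝ) × (Fin m → ℝ) => (z 0).1 := by fun_prop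
    exact ((ObsDriven.measurable_quantileVec P).comp (h.prodMk h')).prodMk
      (h.prodMk (by fun_prop))
  have hcoord : ∀ t ω, ObsDriven.translate t (ObsDriven.path (ObsDriven.inputs U X) ω) 0 =
      (U t ω, X t ω) := by
    intro t ω
    simp [ObsDriven.translate, ObsDriven.path, ObsDriven.inputs]
  refine ⟨Y, lam, ⟨hE', fun t => ae_of_all _ fun ω => rfl, ?_, ?_, ?_, hadapt, ?_⟩, ?_, ?_⟩
  · intro t
    filter_upwards [hrec (t - 1), hE' (t - 1)] with ω h hmem i
    rw [sub_add_cancel] at h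
    rw [h]
    exact ObsDriven.retract_of_mem (hG i) (hgG _ _ _ hmem i)
  · have h := (h1.1.factor ((measurable_fst (α := Fin k → ℝ)).prodMk
      ((measurable_fst (α := (i : Fin k) → G i) (β := Fin m → ℝ)).comp measurable_snd)
      |>.comp hψ)).isStationary
    simpa only [Function.comp_def, hcoord] using h
  · intro t
    have hUt : Measurable[ObsDriven.pastSigma Z t] (U t) :=
      measurable_fst.comp (ObsDriven.measurable_pastSigma Z t)
    exact (ObsDriven.measurable_quantileVec P).comp ((hadapt t).prodMk hUt)
  · exact integrable_finsetSum _ fun i _ => (hlamint 0 i).abs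
  · intro Y' lam' h'
    obtain ⟨hrec', hW⟩ := h'.exists_eq_past hG hg
    choose W hWm hWeq using hW
    have hlamm' : ∀ t, Measurable (lam' t) := fun t => measurable_snd.comp (h'.stationary.1 t)
    -- `W t` may depend on `t`, since `lam'` is not assumed jointly stationary with the inputs.
    set d : ℤ → ENNReal := fun t => ∫⁻ q, ObsDriven.weightedEDist w (W t q) (L q) ∂π with hd
    have hWstep : ∀ t, W (t + 1) =ᵐ[π] ObsDriven.update hG P g (W t) := by
      intro t
      rw [← (hmp (t + 1)).map_eq]
      refine (ae_map_iff (hmp (t + 1)).measurable.aemeasurable (measurableSet_eq_fun (hWm (t + 1))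
        (ObsDriven.measurable_update hG hg (hWm t)))).2 ?_
      filter_upwards [hrec' t, hWeq t, hWeq (t + 1)] with ω h₁ h₂ h₃
      rw [ObsDriven.update_pastSeq, ← h₂, ← h₃]
      exact h₁
    have hdstep : ∀ t, d (t + 1) ≤ ENNReal.ofReal c * d t := by
      intro t
      refine le_trans (le_of_eq (lintegral_congr_ae ?_)) (hcontr (W t) L (hWm t) hL)
      filter_upwards [hWstep t, hfix] with q h₁ h₂
      rw [h₁, h₂]
    -- Triangle inequality through `s`; stationarity of `lam'` makes its share independent of `t`.
    obtain ⟨B, hB, hdB⟩ : ∃ B : ENNReal, B ≠ ⊤ ∧ ∀ t, d t ≤ B := by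
      refine ⟨∫⁻ ω, ObsDriven.weightedEDist w s (lam' 0 ω) ∂μ +
        ∫⁻ q, ObsDriven.weightedEDist w s (L q) ∂π, ENNReal.add_ne_top.2 ⟨?_, hLfin⟩, fun t => ?_⟩
      · exact ObsDriven.lintegral_weightedEDist_ne_top w s (hlamm' 0)
          ((ObsDriven.integrable_sum_abs_iff fun i => by
            have := hlamm' 0
            fun_prop).1 h'.integrable)
      · have hlaw : μ.map (lam' t) = μ.map (lam' 0) := by
          have h := congrArg (Measure.map Prod.snd) (h'.stationary.map_eq t)
          rwa [Measure.map_map measurable_snd (h'.stationary.1 t),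
            Measure.map_map measurable_snd (h'.stationary.1 0)] at h
        have hsm : Measurable fun a : (i : Fin k) → G i => ObsDriven.weightedEDist w s a :=
          ObsDriven.measurable_weightedEDist w measurable_const measurable_id
        have hsW : Measurable fun q => ObsDriven.weightedEDist w s (W t q) := hsm.comp (hWm t)
        have hW0 : ∫⁻ q, ObsDriven.weightedEDist w s (W t q) ∂π =
            ∫⁻ ω, ObsDriven.weightedEDist w s (lam' 0 ω) ∂μ := by
          rw [← lintegral_map hsm (hlamm' 0), ← hlaw, lintegral_map hsm (hlamm' t),
            ← (hmp t).lintegral_comp hsW]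
          refine lintegral_congr_ae ?_
          filter_upwards [hWeq t] with ω h
          rw [h]
        rw [← hW0, ← lintegral_add_left hsW]
        refine lintegral_mono fun q => ?_
        rw [ObsDriven.weightedEDist_comm w s (W t q)]
        exact ObsDriven.weightedEDist_triangle w _ _ _
    have hd0 : ∀ t, d t = 0 := by
      intro t
      have hle : ∀ n : ℕ, d t ≤ ENNReal.ofReal c ^ n * B := by
        intro n
        -- Start `n` steps before `t` and run forward to `t`.
        have h := ObsDriven.le_pow_mul_of_le_mul (d := fun j : ℕ => d (t - n + j))
          (c := ENNReal.ofReal c) (fun j => by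
            have := hdstep (t - n + j)
            push_cast
            rwa [← add_assoc]) n
        simp only [sub_add_cancel] at h
        exact h.trans (by gcongr; exact hdB _)
      have hlim : Filter.Tendsto (fun n : ℕ => ENNReal.ofReal c ^ n * B) Filter.atTop (nhds 0) := by
        simpa using ENNReal.Tendsto.mul_const
          (ENNReal.tendsto_pow_atTop_nhds_zero_of_lt_one hc1') (Or.inr hB)
      exact le_antisymm (ge_of_tendsto' hlim hle) zero_le
    refine ae_all_iff.2 fun t => ?_
    have hWL : W t =ᵐ[π] L := by
      have h := (lintegral_eq_zero_iff
        (ObsDriven.measurable_weightedEDist w (hWm t) hL)).1 (hd0 t)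
      filter_upwards [h] with q hq
      exact ObsDriven.eq_of_weightedEDist_eq_zero hw hq
    filter_upwards [hWeq t, (hmp t).quasiMeasurePreserving.ae hWL, h'.observation_eq t]
      with ω h₁ h₂ h₃
    have h₄ : lam' t ω = lam t ω := h₁.trans h₂
    exact ⟨by rw [h₃, h₄], h₄⟩
  · have h := h1.1.factor hψ
    simpa only [hcoord] using h
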